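/- Let $p$ be a prime number, let $\mathbb{C}_p$ be the completion of an algebraic closure of $\mathbb{Q}_p$ with $|p|_p=p^{-1}$, and fix an embedding $\overline{\mathbb{Q}}\hookrightarrow\mathbb{C}_p$. For $n\ge 1$ let $\mathrm{Res}(t^{n}-1,f(t))=\prod_{\zeta^{n}=1}f(\zeta)$ be the $n$-th cyclic resultant of $f$. For an integer $x\neq 0$ its non-$p$ part is $x\,|x|_p$. For $a\in\mathbb{C}_p$ with $|a-1|_p<1$ put $\log a=\sum_{n\ge1}-(1-a)^n/n$. Let $0\neq f(t)\in\mathbb{Z}[t]$, let $p^\mu$ be the maximal power of $p$ dividing $f(t)$, and write $f(t)=a_0\prod_i(t-\alpha_i)$ in $\overline{\mathbb{Q}}[t]$. Then $\bigl|p^{-\mu}a_0\prod_{|\alpha_j|_p>1}\alpha_j\bigr|_p=1$; there is a unique root of unity $\xi\in\mathbb{C}_p$ of order prime to $p$ with $\bigl|p^{-\mu}a_0\prod_{|\alpha_j|_p>1}\alpha_j-\xi\bigr|_p<1$; and for each $i$ with $|\alpha_i|_p=1$ there is a unique root of unity $\zeta_i\in\mathbb{C}_p$ of order prime to $p$ with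 $|\alpha_i-\zeta_i|_p<1$. Moreover, the following hold. (1) (i) If $p\mid f(t)$, then $\lim_{n\to\infty}\mathrm{Res}(t^{p^n}-1,f(t))=0$ in $\mathbb{Z}_p$. (ii) If $p\nmid f(t)$, then $\mathrm{Res}(t^{p^n}-1,f(t))$ converges in $\mathbb{Z}_p$ and $$\lim_{n\to\infty}\mathrm{Res}(t^{p^n}-1,f(t))=(-1)^{p\deg f+\#\{i\,\mid\,|\alpha_i|_p<1\}}\,\xi\prod_{i;\,|\alpha_i|_p=1}(\zeta_i-1);$$ this limit is zero if and only if $\zeta_i=1$ for some $i$ with $|\alpha_i|_p=1$. (2) Suppose that $\mathrm{Res}(t^{p^n}-1,f(t))\neq0$ for all $n\ge 0$. Then there is a unique $\nu\in\mathbb{Z}$ with $p^{-\nu}=\prod_{i;\,|\alpha_i-1|_p<1}|\log\alpha_i|_p$, and the non-$p$ part of $\mathrm{Res}(t^{p^n}-1,f(t))$ converges in $\mathbb{Z}_p$, as $n\to\infty$, to $$(-1)^{p\deg f+\#\{i\,\mid\,|\alpha_i|_p<1\}}\,\xi\,\Bigl(\prod_{\substack{i;\,|\alpha_i|_p=1,\\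 |\alpha_i-1|_p=1}}(\zeta_i-1)\Bigr)\,p^{-\nu}\prod_{\substack{i;\,|\alpha_i|_p=1,\\ |\alpha_i-1|_p<1}}\log\alpha_i.$$ If all $\alpha_i$ with $|\alpha_i-1|_p<1$ satisfy $|\alpha_i-1|_p<p^{-1/(p-1)}$, then $p^{\nu}=|p^{-\mu}f(1)|_p^{-1}$ (so $p^\nu=|f(1)|_p^{-1}$ when $p\nmid f(t)$). Finally, with $\lambda=\#\{i\mid|\alpha_i-1|_p<1\}$, the numbers $\lambda,\mu,\nu$ are the Iwasawa invariants of $f(t)$, that is, $|\mathrm{Res}(t^{p^n}-1,f(t))|_p^{-1}=p^{\lambda n+\mu p^n+\nu}$ for all sufficiently large $n$. -/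

import Mathlib

open Polynomial Filter Topology

noncomputable section

/-- The `n`-th cyclic resultant `Res(t^n - 1, f(t))`, the determinant of the Sylvester matrix. -/
def cyclicResultant (n : ℕ) (f : ℤ[X]) : ℤ :=
  resultant (X ^ n - 1 : ℤ[X]) f

/-- The non-`p` part of an integer: `m` for `x = m * p ^ r` with `p ∤ m` (and `0` for `x = 0`). -/
def nonPPart (p : ℕ) (x : ℤ) : ℤ :=
  x / (p : ℤ) ^ padicValInt p x

/-- The `p`-adic logarithm `log (1 + x) = ∑_{n ≥ 1} -(-x)^n / n`, used for `‖x‖ < 1`. -/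
def padicComplexLog (p : ℕ) [Fact p.Prime] (a : ℂ_[p]) : ℂ_[p] :=
  ∑' n : ℕ, -(-(a - 1)) ^ (n + 1) / ((n + 1 : ℕ) : ℂ_[p])

/-- `ζ` is a root of unity of order prime to `p` with `|a - ζ|_p < 1`. -/
def IsTeichmullerRep (p : ℕ) [Fact p.Prime] (a ζ : ℂ_[p]) : Prop :=
  IsOfFinOrder ζ ∧ (orderOf ζ).Coprime p ∧ ‖a - ζ‖ < 1

/-- `lam, mu, nu` are the Iwasawa invariants of `f`:
`|Res(t^(p^n) - 1, f(t))|_p⁻¹ = p^(lam * n + mu * p^n + nu)` for all large `n`. -/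
def IsIwasawaInvariants (p : ℕ) [Fact p.Prime] (f : ℤ[X]) (lam mu : ℕ) (nu : ℤ) : Prop :=
  ∀ᶠ n : ℕ in atTop,
    ‖((cyclicResultant (p ^ n) f : ℤ) : ℚ_[p])‖⁻¹ =
      (p : ℝ) ^ ((lam : ℤ) * (n : ℤ) + (mu : ℤ) * (p : ℤ) ^ n + nu)

end

/-! Over `ℂ_[p]` the resultant with `t ^ N - 1` is, up to sign, `a₀ ^ N * ∏ (α i ^ N - 1)`, taken at
`N = p ^ n`. Removing the `p`-content contributes `p ^ (μ * N)` and replaces `a₀` by `b = p ^ (-μ) *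
a₀`. The roots then split by absolute value (`pow_mul_prod_pow_sub_one`). A root outside the unit
disc gives `α ^ N * (1 - α⁻¹ ^ N)`; its `α ^ N` joins `b ^ N`, and the rest tends to `1`. A root
inside the disc contributes a factor tending to `-1`.

The core is the reduction of the primitive part modulo the maximal ideal
(`exists_integral_factorization`, a form of Gauss's lemma). It gives `c = b * ∏ α i` (over `‖α i‖ >
1`) norm one. Since the reduced polynomial has coefficients in the prime field, Frobenius fixes the
class of `c` and permutes those of the unit roots (`frobenius_permutes_unit_roots`). Hence
Teichmüller representatives exist, `c ^ p ^ n` tends to `ξ`, and although `α i ^ p ^ n` need not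
converge, it stays close to `ζ i ^ p ^ n`, whose symmetric products do not depend on `n`.

For a root with `‖α - 1‖ < 1` the factor tends to `0`, but after division by `p ^ n` it tends to
`log α` (`tendsto_pow_sub_one_div_log`). If no resultant vanishes, no root is a `p`-power root of
unity, so these logarithms are nonzero (`log_ne_zero_of_forall_pow_ne_one`). By the ultrametric
inequality the norms of the rescaled resultants are then eventually constant, which produces `ν`,
the Iwasawa formula and the limit of the non-`p` part. -/

section PadicNorm

variable {K : Type*} [NormedField K]

/-- Telescoping one factor at a time. Neither product is assumed to converge, which is what powers
of Teichmüller representatives require. -/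
theorem tendsto_prod_sub_prod_zero {ι : Type*} (s : Finset ι) {x y : ι → ℕ → K}
    (hx : ∀ i ∈ s, ∀ n, ‖x i n‖ ≤ 1) (hy : ∀ i ∈ s, ∀ n, ‖y i n‖ ≤ 1)
    (h : ∀ i ∈ s, Tendsto (fun n => x i n - y i n) atTop (𝓝 0)) :
    Tendsto (fun n => ∏ i ∈ s, x i n - ∏ i ∈ s, y i n) atTop (𝓝 0) := by
  classical
  induction s using Finset.induction_on with
  | empty => simp
  | insert a s ha ih =>
    have ih' := ih (fun i hi => hx i (Finset.mem_insert_of_mem hi))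
      (fun i hi => hy i (Finset.mem_insert_of_mem hi))
      (fun i hi => h i (Finset.mem_insert_of_mem hi))
    have h1 : Tendsto (fun n => (∏ i ∈ s, x i n - ∏ i ∈ s, y i n) * x a n) atTop (𝓝 0) :=
      ih'.zero_mul_isBoundedUnder_le
        (isBoundedUnder_of ⟨1, fun n => hx a (Finset.mem_insert_self _ _) n⟩)
    have h2 : Tendsto (fun n => (x a n - y a n) * ∏ i ∈ s, y i n) atTop (𝓝 0) := by
      refine (h a (Finset.mem_insert_self _ _)).zero_mul_isBoundedUnder_le
        (isBoundedUnder_of ⟨1, fun n => ?_⟩)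
      simp only [Function.comp, norm_prod]
      exact Finset.prod_le_one (fun _ _ => norm_nonneg _)
        fun i hi => hy i (Finset.mem_insert_of_mem hi) n
    have h3 := h1.add h2
    rw [add_zero] at h3
    refine h3.congr fun n => ?_
    rw [Finset.prod_insert ha, Finset.prod_insert ha]
    ring

/-! ### Norms of integers and binomial expansions over `ℚ_[p]` -/

variable (K) (p : ℕ) [hp : Fact p.Prime] [NormedAlgebra ℚ_[p] K]

theorem norm_intCast_eq_padic (z : ℤ) : ‖(z : K)‖ = ‖(z : ℚ_[p])‖ := by
  rw [← map_intCast (algebraMap ℚ_[p] K), norm_algebraMap']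

theorem norm_natCast_eq_padic (z : ℕ) : ‖(z : K)‖ = ‖(z : ℚ_[p])‖ := by
  rw [← map_natCast (algebraMap ℚ_[p] K), norm_algebraMap']

theorem norm_prime : ‖(p : K)‖ = (p : ℝ)⁻¹ := by
  rw [norm_natCast_eq_padic K p, Padic.norm_p]

theorem prime_ne_zero : (p : K) ≠ 0 := by
  rw [← norm_ne_zero_iff, norm_prime K p]
  exact inv_ne_zero (by exact_mod_cast hp.out.ne_zero)

theorem norm_prime_lt_one : ‖(p : K)‖ < 1 := by
  rw [norm_natCast_eq_padic K p]
  exact Padic.norm_p_lt_one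

theorem norm_intCast_lt_one_iff {z : ℤ} : ‖(z : K)‖ < 1 ↔ (p : ℤ) ∣ z := by
  rw [norm_intCast_eq_padic K p]
  exact Padic.norm_intCast_lt_one_iff

theorem norm_natCast_inv_le (p : ℕ) [Fact p.Prime] [NormedAlgebra ℚ_[p] K] (k : ℕ)
    (hk : k ≠ 0) : ‖((k : K))⁻¹‖ ≤ k := by
  have hk' : (k : ℚ_[p]) ≠ 0 := by exact_mod_cast hk
  rw [norm_inv, norm_natCast_eq_padic K p, Padic.norm_eq_zpow_neg_valuation hk',
    Padic.valuation_natCast, ← zpow_neg, neg_neg, zpow_natCast]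
  exact_mod_cast Nat.le_of_dvd (Nat.pos_of_ne_zero hk) pow_padicValNat_dvd

theorem tendsto_prime_pow_zero : Tendsto (fun n : ℕ => (p : K) ^ n) atTop (𝓝 0) :=
  tendsto_pow_atTop_nhds_zero_of_norm_lt_one (norm_prime_lt_one K p)

theorem natCast_ne_zero_of_padic (p : ℕ) [Fact p.Prime] [NormedAlgebra ℚ_[p] K] {k : ℕ}
    (hk : k ≠ 0) : (k : K) ≠ 0 := by
  rw [← norm_ne_zero_iff, norm_natCast_eq_padic K p, norm_ne_zero_iff]
  exact_mod_cast hk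

theorem choose_prime_pow_eq (n k : ℕ) :
    (((p ^ n).choose (k + 1) : ℕ) : K) =
      (p : K) ^ n * (((p ^ n - 1).choose k : ℕ) : K) / ((k + 1 : ℕ) : K) := by
  have h := Nat.add_one_mul_choose_eq (p ^ n - 1) k
  rw [Nat.sub_add_cancel (Nat.one_le_pow _ _ hp.out.pos)] at h
  rw [eq_div_iff (natCast_ne_zero_of_padic K p k.succ_ne_zero)]
  have h' := congrArg (Nat.cast (R := K)) h
  push_cast at h' ⊢
  exact h'.symm

variable {K}

/-- Writing the finite binomial sum as a series makes the index set independent of `n`, so that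
dominated convergence applies. -/
theorem one_add_pow_sub_one_div_eq_tsum (x : K) (n : ℕ) :
    ((1 + x) ^ p ^ n - 1) / (p : K) ^ n =
      ∑' k : ℕ, (((p ^ n - 1).choose k : ℕ) : K) * (x ^ (k + 1) / ((k + 1 : ℕ) : K)) := by
  rw [tsum_eq_sum (s := Finset.range (p ^ n)), div_eq_iff (pow_ne_zero _ (prime_ne_zero K p)),
    add_comm 1 x, add_pow, Finset.sum_range_succ', Finset.sum_mul]
  · simp only [one_pow, mul_one, pow_zero, Nat.choose_zero_right, Nat.cast_one,
      add_sub_cancel_right]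
    refine Finset.sum_congr rfl fun k _ => ?_
    rw [choose_prime_pow_eq K p]
    ring
  · intro k hk
    rw [Finset.mem_range, not_lt] at hk
    rw [Nat.choose_eq_zero_of_lt]
    · simp
    · have := Nat.one_le_pow n p hp.out.pos
      omega

end PadicNorm

/-! ### Iterated `p`-th powers and the logarithm -/

section PadicLimits

variable {K : Type*} [NormedField K] [IsUltrametricDist K]

theorem eventually_norm_eq_of_tendsto {u : ℕ → K} {l : K} (hu : Tendsto u atTop (𝓝 l))
    (hl : l ≠ 0) : ∀ᶠ n in atTop, ‖u n‖ = ‖l‖ := by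
  have h := (tendsto_iff_norm_sub_tendsto_zero.mp hu).eventually_lt_const (norm_pos_iff.mpr hl)
  filter_upwards [h] with n hn
  have := IsUltrametricDist.norm_add_eq_max_of_norm_ne_norm hn.ne
  rw [sub_add_cancel, max_eq_right hn.le] at this
  exact this

theorem norm_sub_one_of_norm_lt_one {x : K} (hx : ‖x‖ < 1) : ‖x - 1‖ = 1 := by
  have h : ‖x‖ ≠ ‖(-1 : K)‖ := by simpa using hx.ne
  have := IsUltrametricDist.norm_add_eq_max_of_norm_ne_norm h
  rw [← sub_eq_add_neg, norm_neg, norm_one, max_eq_right hx.le] at this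
  exact this

theorem norm_sub_one_of_one_lt_norm {x : K} (hx : 1 < ‖x‖) : ‖x - 1‖ = ‖x‖ := by
  have h : ‖x‖ ≠ ‖(-1 : K)‖ := by simpa using hx.ne'
  have := IsUltrametricDist.norm_add_eq_max_of_norm_ne_norm h
  rw [← sub_eq_add_neg, norm_neg, norm_one, max_eq_left hx.le] at this
  exact this

theorem norm_eq_one_of_norm_sub_one_lt_one {x : K} (hx : ‖x - 1‖ < 1) : ‖x‖ = 1 := by
  have h := norm_sub_one_of_norm_lt_one (x := -(x - 1)) (by rwa [norm_neg])
  rwa [show -(x - 1) - 1 = -x by ring, norm_neg] at h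

theorem norm_sub_one_le_one {x : K} (hx : ‖x‖ = 1) : ‖x - 1‖ ≤ 1 := by
  have := IsUltrametricDist.norm_add_le_max x (-1)
  simpa [hx, ← sub_eq_add_neg] using this

variable (p : ℕ) [hp : Fact p.Prime]

section Choose

variable (K) [NormedAlgebra ℚ_[p] K]

/-- By Pascal's rule, consecutive entries of row `p ^ n - 1` add up to an entry of row `p ^ n`,
which tends to `0` because it carries the factor `p ^ n / (k + 1)`. -/
theorem tendsto_choose_prime_pow_sub_one (k : ℕ) :
    Tendsto (fun n : ℕ => (((p ^ n - 1).choose k : ℕ) : K)) atTop (𝓝 ((-1) ^ k)) := by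
  induction k with
  | zero => simp
  | succ k ih =>
    have h1 : Tendsto (fun n : ℕ => (((p ^ n).choose (k + 1) : ℕ) : K)) atTop (𝓝 0) := by
      simp_rw [choose_prime_pow_eq K p]
      have := ((tendsto_prime_pow_zero K p).mul ih).div_const ((k + 1 : ℕ) : K)
      simpa using this
    have h2 := h1.sub ih
    rw [zero_sub, ← neg_one_mul, ← pow_succ'] at h2
    refine h2.congr fun n => ?_
    have h := Nat.choose_succ_succ (p ^ n - 1) k
    rw [Nat.succ_eq_add_one, Nat.sub_add_cancel (Nat.one_le_pow _ _ hp.out.pos)] at h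
    rw [h]
    push_cast
    simp

end Choose

variable [NormedAlgebra ℚ_[p] K]

/-- The `p`-adic logarithm as the limit of `(a ^ p ^ n - 1) / p ^ n`. -/
theorem tendsto_pow_sub_one_div_log [CompleteSpace K] {a : K} (ha : ‖a - 1‖ < 1) :
    Tendsto (fun n : ℕ => (a ^ p ^ n - 1) / (p : K) ^ n) atTop
      (𝓝 (∑' k : ℕ, -(-(a - 1)) ^ (k + 1) / ((k + 1 : ℕ) : K))) := by
  have key : ∀ n : ℕ, (a ^ p ^ n - 1) / (p : K) ^ n =
      ∑' k : ℕ, (((p ^ n - 1).choose k : ℕ) : K) * ((a - 1) ^ (k + 1) / ((k + 1 : ℕ) : K)) := by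
    intro n
    rw [← one_add_pow_sub_one_div_eq_tsum p (a - 1) n, add_sub_cancel]
  simp_rw [key]
  -- The dominating series uses only the crude bound `‖1 / (k + 1)‖ ≤ k + 1`.
  have hs : Summable fun k : ℕ => ((k + 1 : ℕ) : ℝ) * ‖a - 1‖ ^ (k + 1) := by
    have h := summable_pow_mul_geometric_of_norm_lt_one 1 (r := ‖a - 1‖) (by simpa using ha)
    simpa using (summable_nat_add_iff 1).mpr h
  refine tendsto_tsum_of_dominated_convergence hs (fun k => ?_) (Eventually.of_forall fun n k => ?_)
  · have h := (tendsto_choose_prime_pow_sub_one K p k).mul_const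
      ((a - 1) ^ (k + 1) / ((k + 1 : ℕ) : K))
    convert h using 2
    rw [neg_pow (a - 1), pow_succ (-1 : K) k]
    ring
  · rw [norm_mul, div_eq_mul_inv, norm_mul, norm_pow]
    have h1 := IsUltrametricDist.norm_natCast_le_one K ((p ^ n - 1).choose k)
    have h2 := norm_natCast_inv_le K p (k + 1) k.succ_ne_zero
    calc _ ≤ 1 * (‖a - 1‖ ^ (k + 1) * ((k + 1 : ℕ) : ℝ)) := by gcongr
      _ = _ := by ring

theorem tendsto_pow_prime_pow_one [CompleteSpace K] {a : K} (ha : ‖a - 1‖ < 1) :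
    Tendsto (fun n : ℕ => a ^ p ^ n) atTop (𝓝 1) := by
  have h := ((tendsto_pow_sub_one_div_log p ha).mul (tendsto_prime_pow_zero K p)).add_const 1
  rw [mul_zero, zero_add] at h
  refine h.congr fun n => ?_
  rw [div_mul_cancel₀ _ (pow_ne_zero _ (prime_ne_zero K p)), sub_add_cancel]

theorem tendsto_pow_prime_pow_sub [CompleteSpace K] {a z : K} (hz : ‖z‖ = 1)
    (h : ‖a - z‖ < 1) : Tendsto (fun n : ℕ => a ^ p ^ n - z ^ p ^ n) atTop (𝓝 0) := by
  have hz0 : z ≠ 0 := norm_ne_zero_iff.mp (by rw [hz]; exact one_ne_zero)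
  have hb : ‖a / z - 1‖ < 1 := by
    rw [div_sub_one hz0, norm_div, hz, div_one]
    exact h
  have h1 := (tendsto_pow_prime_pow_one p hb).sub_const 1
  rw [sub_self] at h1
  have h2 := h1.zero_mul_isBoundedUnder_le (g := fun n : ℕ => z ^ p ^ n)
    (isBoundedUnder_of ⟨1, fun n => by simp [hz]⟩)
  refine h2.congr fun n => ?_
  rw [sub_mul, ← mul_pow, div_mul_cancel₀ _ hz0, one_mul]

/-- With `a = 1 + y`, the linear term `p * y` strictly dominates the expansion: the middle binomial
coefficients carry another `p` against a higher power of `y`, and the bound on `‖y‖ ^ (p - 1)` says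
exactly that `y ^ p` is smaller. -/
theorem norm_pow_prime_sub_one {a : K} (ha : ‖a - 1‖ ^ (p - 1) < (p : ℝ)⁻¹) :
    ‖a ^ p - 1‖ = (p : ℝ)⁻¹ * ‖a - 1‖ := by
  obtain ⟨y, rfl⟩ : ∃ y, a = 1 + y := ⟨a - 1, by ring⟩
  rw [add_sub_cancel_left] at ha ⊢
  by_cases hy : y = 0
  · simp [hy]
  have hy0 : 0 < ‖y‖ := norm_pos_iff.mpr hy
  have hp0 : (0 : ℝ) < (p : ℝ)⁻¹ := inv_pos.mpr (by exact_mod_cast hp.out.pos)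
  have hp1 : p - 1 ≠ 0 := by have := hp.out.two_le; omega
  have hy1 : ‖y‖ < 1 := by
    by_contra hcon
    have h1 : 1 ≤ ‖y‖ ^ (p - 1) := one_le_pow₀ (not_lt.mp hcon)
    have h2 : (p : ℝ)⁻¹ ≤ 1 := inv_le_one_of_one_le₀ (by exact_mod_cast hp.out.one_le)
    linarith
  obtain ⟨q, hq⟩ : ∃ q, p = q + 1 := ⟨p - 1, by have := hp.out.two_le; omega⟩
  have expand : (1 + y) ^ p - 1 =
      ∑ k ∈ Finset.range q, y ^ (k + 2) * ((p.choose (k + 2) : ℕ) : K) + (p : K) * y := by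
    rw [add_comm 1 y, add_pow, Finset.sum_range_succ', hq, Finset.sum_range_succ']
    simp
    ring
  have hlt : ‖∑ k ∈ Finset.range q, y ^ (k + 2) * ((p.choose (k + 2) : ℕ) : K)‖ <
      ‖(p : K) * y‖ := by
    obtain ⟨i, hi, hle⟩ := IsUltrametricDist.exists_norm_finsetSum_le (Finset.range q)
      fun k => y ^ (k + 2) * ((p.choose (k + 2) : ℕ) : K)
    refine hle.trans_lt ?_
    have hq0 : (Finset.range q).Nonempty := by
      rw [Finset.nonempty_range_iff]; omega
    have hiq := Finset.mem_range.mp (hi hq0)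
    rw [norm_mul, norm_mul, norm_prime K p, norm_pow]
    by_cases hlast : i + 2 = p
    · rw [hlast, Nat.choose_self, Nat.cast_one, norm_one, mul_one,
        ← Nat.sub_add_cancel hp.out.one_le, pow_succ, Nat.sub_add_cancel hp.out.one_le]
      gcongr
    · have hdvd : p ∣ p.choose (i + 2) :=
        hp.out.dvd_choose_self (by omega) (by omega)
      obtain ⟨c, hc⟩ := hdvd
      rw [hc, Nat.cast_mul, norm_mul, norm_prime K p]
      have hc1 := IsUltrametricDist.norm_natCast_le_one K c
      have h2 : ‖y‖ ^ (i + 2) < ‖y‖ := by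
        calc ‖y‖ ^ (i + 2) < ‖y‖ ^ 1 := pow_lt_pow_right_of_lt_one₀ hy0 hy1 (by omega)
          _ = ‖y‖ := pow_one _
      calc ‖y‖ ^ (i + 2) * ((p : ℝ)⁻¹ * ‖(c : K)‖) ≤ ‖y‖ ^ (i + 2) * ((p : ℝ)⁻¹ * 1) := by gcongr
        _ = (p : ℝ)⁻¹ * ‖y‖ ^ (i + 2) := by ring
        _ < (p : ℝ)⁻¹ * ‖y‖ := by gcongr
  rw [expand, IsUltrametricDist.norm_add_eq_max_of_norm_ne_norm hlt.ne, max_eq_right hlt.le,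
    norm_mul, norm_prime K p]

theorem norm_pow_prime_pow_sub_one {a : K} (ha : ‖a - 1‖ ^ (p - 1) < (p : ℝ)⁻¹) (n : ℕ) :
    ‖a ^ p ^ n - 1‖ = ((p : ℝ)⁻¹) ^ n * ‖a - 1‖ := by
  induction n with
  | zero => simp
  | succ n ih =>
    have hp1 : (p : ℝ)⁻¹ ≤ 1 := inv_le_one_of_one_le₀ (by exact_mod_cast hp.out.one_le)
    rw [pow_succ, pow_mul, norm_pow_prime_sub_one p, ih, pow_succ]
    · ring
    · refine lt_of_le_of_lt ?_ ha
      rw [ih]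
      gcongr
      exact mul_le_of_le_one_left (norm_nonneg _) (pow_le_one₀ (by positivity) hp1)

theorem norm_log_of_norm_sub_one_pow_lt [CompleteSpace K] {a : K}
    (ha : ‖a - 1‖ ^ (p - 1) < (p : ℝ)⁻¹) (ha1 : ‖a - 1‖ < 1) :
    ‖∑' k : ℕ, -(-(a - 1)) ^ (k + 1) / ((k + 1 : ℕ) : K)‖ = ‖a - 1‖ := by
  refine tendsto_nhds_unique (tendsto_pow_sub_one_div_log p ha1).norm ?_
  refine tendsto_const_nhds.congr fun n => ?_
  have : ((p : ℝ)⁻¹) ^ n ≠ 0 := pow_ne_zero _ (inv_ne_zero (by exact_mod_cast hp.out.ne_zero))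
  rw [norm_div, norm_pow, norm_prime K p, norm_pow_prime_pow_sub_one p ha,
    mul_div_cancel_left₀ _ this]

/-- Some power `a ^ p ^ m` enters the disc where each `p`-th power scales the distance to `1` by
exactly `1 / p`. From there on the norms of the quotients defining the logarithm are constant and
nonzero. -/
theorem log_ne_zero_of_forall_pow_ne_one [CompleteSpace K] {a : K} (ha1 : ‖a - 1‖ < 1)
    (h : ∀ n : ℕ, a ^ p ^ n ≠ 1) :
    ∑' k : ℕ, -(-(a - 1)) ^ (k + 1) / ((k + 1 : ℕ) : K) ≠ 0 := by
  have hp0 : (0 : ℝ) < (p : ℝ)⁻¹ := inv_pos.mpr (by exact_mod_cast hp.out.pos)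
  have hp1 : p - 1 ≠ 0 := by have := hp.out.two_le; omega
  have h0 : Tendsto (fun n : ℕ => ‖a ^ p ^ n - 1‖ ^ (p - 1)) atTop (𝓝 0) := by
    have := ((tendsto_pow_prime_pow_one p ha1).sub_const 1).norm.pow (p - 1)
    simpa [hp1] using this
  obtain ⟨m, hm⟩ := (h0.eventually_lt_const hp0).exists
  rw [← norm_ne_zero_iff]
  have h1 : Tendsto (fun n : ℕ => ‖(a ^ p ^ (n + m) - 1) / (p : K) ^ (n + m)‖) atTop
      (𝓝 (‖a ^ p ^ m - 1‖ / ((p : ℝ)⁻¹) ^ m)) := by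
    refine tendsto_const_nhds.congr fun n => ?_
    rw [norm_div, norm_pow, norm_prime K p, pow_add p, mul_comm (p ^ n), pow_mul,
      norm_pow_prime_pow_sub_one p hm, pow_add]
    have hn : ((p : ℝ)⁻¹) ^ n ≠ 0 := pow_ne_zero _ hp0.ne'
    rw [mul_div_mul_left _ _ hn]
  have h2 := ((tendsto_pow_sub_one_div_log p ha1).comp (tendsto_add_atTop_nat m)).norm
  rw [tendsto_nhds_unique h2 h1]
  exact div_ne_zero (norm_ne_zero_iff.mpr (sub_ne_zero.mpr (h m))) (pow_ne_zero _ hp0.ne')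

end PadicLimits

theorem exists_perm_of_map_univ_eq {ι β : Type*} [Fintype ι] {f g : ι → β}
    (h : (Finset.univ.val : Multiset ι).map f = Finset.univ.val.map g) :
    ∃ σ : Equiv.Perm ι, ∀ i, g (σ i) = f i := by
  classical
  have hc : ∀ b, Nonempty ({i // f i = b} ≃ {i // g i = b}) := by
    intro b
    refine ⟨Fintype.equivOfCardEq ?_⟩
    have h1 := congrArg (Multiset.count b) h
    rw [Multiset.count_map, Multiset.count_map] at h1
    rw [Fintype.card_subtype, Fintype.card_subtype]
    simpa [eq_comm, Finset.card_def] using h1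
  let e' := fun b => Classical.choice (hc b)
  refine ⟨(Equiv.sigmaFiberEquiv f).symm.trans
    ((Equiv.sigmaCongrRight e').trans (Equiv.sigmaFiberEquiv g)), fun i => ?_⟩
  exact (e' (f i) ⟨i, rfl⟩).2

theorem prod_eq_prod_norm_trichotomy {K M : Type*} [NormedField K] [CommMonoid M] {ι : Type*}
    [Fintype ι] (α : ι → K) (F : ι → M) :
    ∏ i, F i = (∏ i with 1 < ‖α i‖, F i) * (∏ i with ‖α i‖ < 1, F i) * ∏ i with ‖α i‖ = 1, F i := by
  simp only [Finset.prod_filter, ← Finset.prod_mul_distrib]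
  refine Finset.prod_congr rfl fun i _ => ?_
  rcases lt_trichotomy ‖α i‖ 1 with h | h | h
  · simp [h, h.le, h.ne]
  · simp [h]
  · simp [h, h.le, h.ne']

/-! ### Reduction modulo the maximal ideal and Frobenius -/

section Reduction

variable {K : Type*} [NormedField K] [IsUltrametricDist K]

variable (K) in
/-- The valuation subring `‖x‖ ≤ 1` of an ultrametric normed field. -/
noncomputable abbrev unitBallSubring : ValuationSubring K :=
  Valuation.valuationSubring (NormedField.valuation (K := K))

theorem mem_unitBall_iff {x : K} : x ∈ unitBallSubring K ↔ ‖x‖ ≤ 1 := Iff.rfl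

theorem residue_unitBall_eq_zero_iff (x : unitBallSubring K) :
    IsLocalRing.residue (unitBallSubring K) x = 0 ↔ ‖(x : K)‖ < 1 := by
  rw [IsLocalRing.residue_eq_zero_iff, IsLocalRing.mem_maximalIdeal, mem_nonunits_iff]
  have hu : IsUnit x ↔ NormedField.valuation (x : K) = 1 :=
    (Valuation.integer.integers (NormedField.valuation (K := K))).isUnit_iff_valuation_eq_one
  rw [hu]
  have h := mem_unitBall_iff.mp x.2
  constructor
  · intro h1
    exact lt_of_le_of_ne h fun h2 => h1 (NNReal.eq h2)
  · intro h1 h2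
    exact h1.ne (congrArg NNReal.toReal h2)

theorem residue_unitBall_eq_iff (x y : unitBallSubring K) :
    IsLocalRing.residue (unitBallSubring K) x = IsLocalRing.residue (unitBallSubring K) y ↔
      ‖(x : K) - y‖ < 1 := by
  rw [← sub_eq_zero, ← map_sub, residue_unitBall_eq_zero_iff]
  rfl

variable (p : ℕ) [hp : Fact p.Prime] [NormedAlgebra ℚ_[p] K]

variable (K) in
theorem charP_residueField_unitBall : CharP (IsLocalRing.ResidueField (unitBallSubring K)) p := by
  refine (CharP.charP_iff_prime_eq_zero hp.out).mpr ?_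
  rw [← map_natCast (IsLocalRing.residue (unitBallSubring K)), residue_unitBall_eq_zero_iff]
  exact norm_prime_lt_one K p

variable {ι : Type*} [Fintype ι]

theorem map_residue_eq_zero_of_norm_coeff_lt_one {P : (unitBallSubring K)[X]}
    (h : ∀ n, ‖((P.coeff n : unitBallSubring K) : K)‖ < 1) :
    P.map (IsLocalRing.residue (unitBallSubring K)) = 0 := by
  ext n
  rw [coeff_map, coeff_zero, residue_unitBall_eq_zero_iff]
  exact h n

/-- A polynomial with `p`-adically integral coefficients and nonzero reduction factors over the unit
ball as a unit times linear factors that reduce to `-1`, `X` or `X - α i`. -/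
theorem exists_integral_factorization {g : ℤ[X]} (hg : ¬ C (p : ℤ) ∣ g) {a : K} {α : ι → K}
    (hfac : g.map (Int.castRingHom K) = C a * ∏ i, (X - C (α i))) :
    ∃ (c : unitBallSubring K) (v : ι → unitBallSubring K),
      (c : K) = a * ∏ i with 1 < ‖α i‖, α i ∧ ‖(c : K)‖ = 1 ∧
      (∀ i, ‖α i‖ = 1 → (v i : K) = α i) ∧
      g.map (Int.castRingHom (IsLocalRing.ResidueField (unitBallSubring K))) =
        C (IsLocalRing.residue _ c) * ((∏ i with 1 < ‖α i‖, (-1)) * (∏ i with ‖α i‖ < 1, X) *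
          ∏ i with ‖α i‖ = 1, (X - C (IsLocalRing.residue _ (v i)))) := by
  set c₀ : K := a * ∏ i with 1 < ‖α i‖, α i with hc₀
  -- Factors with a large root are rescaled to `α⁻¹ * X - 1`, the scalar `α` moving into `c₀`; every
  -- factor `u * X - v` is then integral with nonzero reduction.
  have hu : ∀ i, ∃ u : unitBallSubring K, (u : K) = if 1 < ‖α i‖ then (α i)⁻¹ else 1 := by
    intro i
    refine ⟨⟨if 1 < ‖α i‖ then (α i)⁻¹ else 1, ?_⟩, rfl⟩
    rw [mem_unitBall_iff]
    split_ifs with h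
    · rw [norm_inv]; exact inv_le_one_of_one_le₀ h.le
    · simp
  have hv : ∀ i, ∃ v : unitBallSubring K, (v : K) = if 1 < ‖α i‖ then 1 else α i := by
    intro i
    refine ⟨⟨if 1 < ‖α i‖ then 1 else α i, ?_⟩, rfl⟩
    rw [mem_unitBall_iff]
    split_ifs with h
    · simp
    · exact not_lt.mp h
  choose u hu using hu
  choose v hv using hv
  set H : (unitBallSubring K)[X] := ∏ i, (C (u i) * X - C (v i)) with hH
  have hHK : g.map (Int.castRingHom K) = C c₀ * H.map (unitBallSubring K).subtype := by
    rw [hfac, hH, hc₀, Finset.prod_filter, Polynomial.map_prod, C_mul, mul_assoc, map_prod,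
      ← Finset.prod_mul_distrib]
    congr 1
    refine Finset.prod_congr rfl fun i _ => ?_
    simp only [Polynomial.map_sub, Polynomial.map_mul, map_C, map_X, ValuationSubring.subtype_apply,
      hu, hv]
    split_ifs with h
    · have h0 : α i ≠ 0 := norm_pos_iff.mp (one_pos.trans h)
      rw [mul_sub, ← mul_assoc, ← C_mul, mul_inv_cancel₀ h0]
      simp
    · simp
  have hHres : H.map (IsLocalRing.residue (unitBallSubring K)) =
      (∏ i with 1 < ‖α i‖, (-1)) * (∏ i with ‖α i‖ < 1, X) *
          ∏ i with ‖α i‖ = 1, (X - C (IsLocalRing.residue _ (v i))) := by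
    rw [hH, Polynomial.map_prod, prod_eq_prod_norm_trichotomy α]
    simp only [Polynomial.map_sub, Polynomial.map_mul, map_C, map_X]
    congr 1
    · congr 1
      · refine Finset.prod_congr rfl fun i hi => ?_
        have h := (Finset.mem_filter.mp hi).2
        have h1 : IsLocalRing.residue (unitBallSubring K) (u i) = 0 := by
          rw [residue_unitBall_eq_zero_iff, hu, if_pos h, norm_inv]
          exact inv_lt_one_of_one_lt₀ h
        have h2 : v i = 1 := Subtype.ext (by rw [hv, if_pos h]; rfl)
        simp [h1, h2]
      · refine Finset.prod_congr rfl fun i hi => ?_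
        have h := (Finset.mem_filter.mp hi).2
        have h1 : IsLocalRing.residue (unitBallSubring K) (v i) = 0 := by
          rw [residue_unitBall_eq_zero_iff, hv, if_neg h.not_gt]
          exact h
        have h2 : u i = 1 := Subtype.ext (by rw [hu, if_neg h.not_gt]; rfl)
        simp [h1, h2]
    · refine Finset.prod_congr rfl fun i hi => ?_
      have h := (Finset.mem_filter.mp hi).2
      have h2 : u i = 1 := Subtype.ext (by rw [hu, if_neg h.not_gt]; rfl)
      simp [h2]
  have hHne : H.map (IsLocalRing.residue (unitBallSubring K)) ≠ 0 := by
    rw [hHres]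
    refine mul_ne_zero (mul_ne_zero ?_ ?_) ?_
    · exact Finset.prod_ne_zero_iff.mpr fun _ _ => neg_ne_zero.mpr one_ne_zero
    · exact Finset.prod_ne_zero_iff.mpr fun _ _ => X_ne_zero
    · exact Finset.prod_ne_zero_iff.mpr fun _ _ => X_sub_C_ne_zero _
  have hcoeff : ∀ n, ((g.coeff n : ℤ) : K) = c₀ * ((H.coeff n : unitBallSubring K) : K) := by
    intro n
    have := congrArg (fun P => coeff P n) hHK
    simpa using this
  have hc1 : ‖c₀‖ = 1 := by
    -- Norm above one would make the nonzero reduction of `H` vanish; norm below one would make `p`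
    -- divide every coefficient of `g`.
    refine le_antisymm (not_lt.mp fun h => hHne ?_) (not_lt.mp fun h => hg ?_)
    · refine map_residue_eq_zero_of_norm_coeff_lt_one fun n => ?_
      have h1 : ‖((g.coeff n : ℤ) : K)‖ ≤ 1 := IsUltrametricDist.norm_intCast_le_one K _
      rw [hcoeff, norm_mul] at h1
      by_contra h2
      have := mul_le_mul h.le (not_lt.mp h2) zero_le_one (norm_nonneg c₀)
      nlinarith [norm_nonneg c₀]
    · rw [C_dvd_iff_dvd_coeff]
      intro n
      rw [← norm_intCast_lt_one_iff K p, hcoeff, norm_mul]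
      have h1 : ‖((H.coeff n : unitBallSubring K) : K)‖ ≤ 1 := mem_unitBall_iff.mp (H.coeff n).2
      nlinarith [norm_nonneg c₀]
  refine ⟨⟨c₀, mem_unitBall_iff.mpr hc1.le⟩, v, rfl, hc1, fun i hi => ?_, ?_⟩
  · rw [hv, if_neg hi.not_gt]
  · rw [← hHres, ← map_C, ← Polynomial.map_mul]
    ext n
    rw [coeff_map, coeff_map, coeff_C_mul, eq_intCast, ← map_intCast (IsLocalRing.residue (unitBallSubring K))]
    congr 1
    refine Subtype.ext ?_
    simpa using hcoeff n

/-- The `p`-th power map fixes the normalized leading coefficient and permutes the unit roots, modulo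
the maximal ideal. -/
theorem frobenius_permutes_unit_roots {g : ℤ[X]} (hg : ¬ C (p : ℤ) ∣ g) {a : K} {α : ι → K}
    (hfac : g.map (Int.castRingHom K) = C a * ∏ i, (X - C (α i))) :
    ‖a * ∏ i with 1 < ‖α i‖, α i‖ = 1 ∧
    ‖(a * ∏ i with 1 < ‖α i‖, α i) ^ p - a * ∏ i with 1 < ‖α i‖, α i‖ < 1 ∧
    ∃ σ : Equiv.Perm {i // ‖α i‖ = 1}, ∀ i, ‖α (σ i) - α i ^ p‖ < 1 := by
  obtain ⟨c, v, hc, hc1, hv, hres⟩ := exists_integral_factorization p hg hfac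
  rw [← hc]
  have := charP_residueField_unitBall K p
  set k := IsLocalRing.ResidueField (unitBallSubring K)
  set r := IsLocalRing.residue (unitBallSubring K)
  set P : k[X] := g.map (Int.castRingHom k) with hP
  -- The coefficients come from `ℤ`, hence lie in the prime field.
  have hfrob : P.map (frobenius k p) = P := by
    rw [hP, Polynomial.map_map]
    congr 1
    exact RingHom.ext_int _ _
  have hrc : r c ≠ 0 := by
    rw [Ne, residue_unitBall_eq_zero_iff, hc1]
    exact lt_irrefl _
  set M : Multiset k := (Finset.univ : Finset {i // ‖α i‖ = 1}).val.map fun i : {i // ‖α i‖ = 1} => r (v i) with hM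
  set N : Multiset k := Multiset.replicate (Finset.card {i | ‖α i‖ < 1}) 0 + M with hN
  set b : k := r c * (-1) ^ (Finset.card {i | 1 < ‖α i‖}) with hb
  have hb0 : b ≠ 0 := mul_ne_zero hrc (pow_ne_zero _ (neg_ne_zero.mpr one_ne_zero))
  have hprod : ∏ i with ‖α i‖ = 1, (X - C (r (v i))) = (M.map fun x => X - C x).prod := by
    rw [hM, Multiset.map_map, ← Finset.prod_eq_multiset_prod]
    exact Finset.prod_subtype _ (by simp) fun i => X - C (r (v i))
  have hPN : P = C b * (N.map fun x => X - C x).prod := by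
    rw [hres, hprod, hN, hb, Multiset.map_add, Multiset.prod_add, Multiset.map_replicate,
      Multiset.prod_replicate, Finset.prod_const, Finset.prod_const, C_mul, C_pow, C_neg, C_1, C_0,
      sub_zero]
    ring
  have hroots : P.roots = N := by
    rw [hPN, roots_C_mul _ hb0, roots_multiset_prod_X_sub_C]
  have hlead : P.leadingCoeff = b := by
    rw [hPN, leadingCoeff_mul, leadingCoeff_C,
      (monic_multiset_prod_of_monic _ _ fun x _ => monic_X_sub_C x).leadingCoeff, mul_one]
  have hsplits : P.Splits := by
    rw [hPN]
    refine (Splits.C _).mul (Splits.multisetProd fun q hq => ?_)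
    obtain ⟨x, -, rfl⟩ := Multiset.mem_map.mp hq
    exact Splits.X_sub_C x
  refine ⟨hc1, ?_, ?_⟩
  · have h1 := congrArg leadingCoeff hfrob
    rw [leadingCoeff_map, hlead, hb, map_mul, map_pow, map_neg, map_one] at h1
    have h2 := mul_right_cancel₀ (pow_ne_zero _ (neg_ne_zero.mpr one_ne_zero)) h1
    rw [frobenius_def, ← map_pow] at h2
    exact (residue_unitBall_eq_iff _ _).mp h2
  · have h1 : P.roots.map (frobenius k p) = P.roots := by
      rw [← hsplits.roots_map, hfrob]
    -- Frobenius fixes the root `0`, so its copies cancel and the multiset of unit roots is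
    -- preserved.
    rw [hroots, hN, Multiset.map_add, Multiset.map_replicate, map_zero] at h1
    have h2 := add_left_cancel h1
    rw [hM, Multiset.map_map] at h2
    obtain ⟨σ, hσ⟩ := exists_perm_of_map_univ_eq h2
    refine ⟨σ, fun i => ?_⟩
    have h3 := hσ i
    rw [Function.comp_apply, frobenius_def, ← map_pow] at h3
    have h4 := (residue_unitBall_eq_iff _ _).mp h3
    rwa [hv _ (σ i).2, SubmonoidClass.coe_pow, hv _ i.2] at h4

end Reduction

/-! ### Existence and uniqueness of Teichmüller representatives -/

section TeichmullerRep

section Ultrametric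

variable {K : Type*} [NormedField K] [IsUltrametricDist K]

theorem norm_pow_sub_pow_lt_one {a b : K} (ha : ‖a‖ ≤ 1) (hb : ‖b‖ ≤ 1) (h : ‖a - b‖ < 1) (n : ℕ) :
    ‖a ^ n - b ^ n‖ < 1 := by
  have h1 := (residue_unitBall_eq_iff ⟨a, mem_unitBall_iff.mpr ha⟩
    ⟨b, mem_unitBall_iff.mpr hb⟩).mpr h
  have h2 := congrArg (· ^ n) h1
  simp only [← map_pow] at h2
  exact (residue_unitBall_eq_iff _ _).mp h2

theorem norm_sub_lt_one_trans {a b c : K} (h₁ : ‖a - b‖ < 1) (h₂ : ‖b - c‖ < 1) : ‖a - c‖ < 1 := by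
  rw [← sub_add_sub_cancel a b c]
  exact (IsUltrametricDist.norm_add_le_max _ _).trans_lt (max_lt h₁ h₂)

/-- If `z ≠ 1`, then `1 + z + ⋯ + z ^ (m - 1) = 0`; this reduces to `m = 0` in the residue field,
forcing `p ∣ m`. -/
theorem eq_one_of_pow_eq_one_of_norm_sub_one_lt_one (p : ℕ) [hp : Fact p.Prime]
    [NormedAlgebra ℚ_[p] K] {z : K} {m : ℕ} (hm : m.Coprime p) (hz : z ^ m = 1)
    (h : ‖z - 1‖ < 1) : z = 1 := by
  have := charP_residueField_unitBall K p
  by_contra hne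
  have hz1 := norm_eq_one_of_norm_sub_one_lt_one h
  set w : unitBallSubring K := ⟨z, mem_unitBall_iff.mpr hz1.le⟩
  have hw : IsLocalRing.residue (unitBallSubring K) w = 1 := by
    rw [← map_one (IsLocalRing.residue (unitBallSubring K))]
    exact (residue_unitBall_eq_iff _ _).mpr h
  have hsum : ∑ i ∈ Finset.range m, w ^ i = 0 := by
    have h1 : (∑ i ∈ Finset.range m, w ^ i) * (w - 1) = 0 := by
      rw [geom_sum_mul, sub_eq_zero]
      exact Subtype.ext hz
    refine (mul_eq_zero.mp h1).resolve_right fun h2 => hne ?_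
    exact congrArg Subtype.val (sub_eq_zero.mp h2)
  have h3 := congrArg (IsLocalRing.residue (unitBallSubring K)) hsum
  rw [map_sum, map_zero] at h3
  simp only [map_pow, hw, one_pow, Finset.sum_const, Finset.card_range, nsmul_eq_mul, mul_one] at h3
  rw [CharP.cast_eq_zero_iff _ p] at h3
  exact hp.out.one_lt.ne' ((Nat.gcd_eq_right h3).symm.trans hm)

end Ultrametric

variable {p : ℕ} [hp : Fact p.Prime] {a b z w : ℂ_[p]}

theorem IsTeichmullerRep.norm_eq_one (h : IsTeichmullerRep p a z) : ‖z‖ = 1 := 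
  h.1.norm_eq_one

theorem IsTeichmullerRep.ne_zero (h : IsTeichmullerRep p a z) : z ≠ 0 :=
  norm_ne_zero_iff.mp (by rw [h.norm_eq_one]; exact one_ne_zero)

theorem IsTeichmullerRep.eq (h₁ : IsTeichmullerRep p a z) (h₂ : IsTeichmullerRep p a w) :
    z = w := by
  have hw0 := h₂.ne_zero
  rw [← div_eq_one_iff_eq hw0]
  refine eq_one_of_pow_eq_one_of_norm_sub_one_lt_one p (Nat.Coprime.mul_left h₁.2.1 h₂.2.1) ?_ ?_
  · rw [div_pow, pow_mul, pow_orderOf_eq_one, one_pow, mul_comm, pow_mul, pow_orderOf_eq_one,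
      one_pow, div_one]
  · rw [div_sub_one hw0, norm_div, h₂.norm_eq_one, div_one]
    refine norm_sub_lt_one_trans ?_ h₂.2.2
    rw [norm_sub_rev]
    exact h₁.2.2

theorem IsTeichmullerRep.congr (h : IsTeichmullerRep p a z) (hab : ‖b - a‖ < 1) :
    IsTeichmullerRep p b z :=
  ⟨h.1, h.2.1, norm_sub_lt_one_trans hab h.2.2⟩

theorem IsTeichmullerRep.pow (h : IsTeichmullerRep p a z) (ha : ‖a‖ = 1) (n : ℕ) :
    IsTeichmullerRep p (a ^ n) (z ^ n) :=
  ⟨h.1.pow, Nat.Coprime.coprime_dvd_left (orderOf_pow_dvd n) h.2.1,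
    norm_pow_sub_pow_lt_one ha.le h.norm_eq_one.le h.2.2 n⟩

theorem isTeichmullerRep_one_iff : IsTeichmullerRep p a 1 ↔ ‖a - 1‖ < 1 := by
  simp [IsTeichmullerRep, IsOfFinOrder.one]

theorem IsTeichmullerRep.eq_one_iff (h : IsTeichmullerRep p a z) : z = 1 ↔ ‖a - 1‖ < 1 := by
  rw [← isTeichmullerRep_one_iff]
  exact ⟨fun hz => hz ▸ h, fun h1 => h.eq h1⟩

theorem IsTeichmullerRep.pow_prime_pow_eq_one_iff (h : IsTeichmullerRep p a z) (n : ℕ) :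
    z ^ p ^ n = 1 ↔ z = 1 := by
  rw [← orderOf_dvd_iff_pow_eq_one]
  refine ⟨fun h1 => ?_, fun h1 => by simp [h1]⟩
  exact orderOf_eq_one_iff.mp (Nat.Coprime.eq_one_of_dvd (h.2.1.pow_right n) h1)

/-- No Hensel lifting is needed. With `m = p ^ k - 1`, the small number `a ^ m - 1` is the product
of the differences `a - z` over the `m`-th roots of unity, so some difference has norm below one. -/
theorem existsUnique_isTeichmullerRep {k : ℕ} (hk : k ≠ 0) (ha : ‖a‖ = 1)
    (h : ‖a ^ p ^ k - a‖ < 1) : ∃! z, IsTeichmullerRep p a z := by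
  suffices hex : ∃ z, IsTeichmullerRep p a z by
    obtain ⟨z, hz⟩ := hex
    exact ⟨z, hz, fun w hw => hw.eq hz⟩
  have hpk : 1 < p ^ k := Nat.one_lt_pow hk hp.out.one_lt
  obtain ⟨m, hm⟩ : ∃ m, p ^ k = m + 1 := ⟨p ^ k - 1, by omega⟩
  have hm0 : m ≠ 0 := by omega
  have h1 : ‖a ^ m - 1‖ < 1 := by
    rw [hm, pow_succ, ← sub_one_mul, norm_mul, ha, mul_one] at h
    exact h
  have hmonic : (X ^ m - 1 : ℂ_[p][X]).Monic := by
    simpa using monic_X_pow_sub_C (1 : ℂ_[p]) hm0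
  have heval := (IsAlgClosed.splits (X ^ m - 1 : ℂ_[p][X])).eval_eq_prod_roots_of_monic hmonic a
  rw [eval_sub, eval_pow, eval_X, eval_one] at heval
  obtain ⟨z, hz, hza⟩ : ∃ z ∈ (X ^ m - 1 : ℂ_[p][X]).roots, ‖a - z‖ < 1 := by
    by_contra hcon
    push Not at hcon
    refine h1.not_ge ?_
    rw [heval]
    have : ∀ s : Multiset ℂ_[p], (∀ z ∈ s, 1 ≤ ‖a - z‖) → 1 ≤ ‖(s.map fun z => a - z).prod‖ := by
      intro s
      induction s using Multiset.induction_on with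
      | empty => simp
      | cons x s ih =>
        intro hs
        rw [Multiset.map_cons, Multiset.prod_cons, norm_mul]
        exact one_le_mul_of_one_le_of_one_le (hs x (Multiset.mem_cons_self x s))
          (ih fun z hz => hs z (Multiset.mem_cons_of_mem hz))
    exact this _ hcon
  have hzm : z ^ m = 1 := by
    have := (mem_roots'.mp hz).2
    rw [IsRoot.def, eval_sub, eval_pow, eval_X, eval_one, sub_eq_zero] at this
    exact this
  refine ⟨z, isOfFinOrder_iff_pow_eq_one.mpr ⟨m, Nat.pos_of_ne_zero hm0, hzm⟩, ?_, hza⟩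
  refine Nat.Coprime.coprime_dvd_left (orderOf_dvd_of_pow_eq_one hzm) ?_
  have hcop : m.Coprime (p ^ k) := by
    rw [hm]
    exact Nat.coprime_self_add_right.mpr (Nat.coprime_one_right m)
  exact Nat.Coprime.coprime_dvd_right (dvd_pow_self p hk) hcop

end TeichmullerRep

/-! ### The resultant as a product over roots -/

section CyclicResultant

theorem cyclicResultant_eq {K : Type*} [Field K] [CharZero K] {f : ℤ[X]} (hf : f ≠ 0) {ι : Type*}
    [Fintype ι] {a : K} {α : ι → K}
    (hfac : f.map (Int.castRingHom K) = C a * ∏ i, (X - C (α i))) (n : ℕ) :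
    ((cyclicResultant n f : ℤ) : K) =
      (-1) ^ (n * f.natDegree) * (a ^ n * ∏ i, (α i ^ n - 1)) := by
  have hinj : Function.Injective (Int.castRingHom K) := Int.cast_injective
  have ha : a ≠ 0 := by
    rintro rfl
    rw [C_0, zero_mul, Polynomial.map_eq_zero_iff hinj] at hfac
    exact hf hfac
  have hmon : ∀ i ∈ Finset.univ, (X - C (α i)).Monic := fun i _ => monic_X_sub_C _
  have hdeg : f.natDegree = (∏ i, (X - C (α i))).natDegree := by
    rw [← natDegree_map_eq_of_injective hinj, hfac, natDegree_C_mul ha]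
  have hcard : (∏ i, (X - C (α i))).natDegree = Fintype.card ι := by
    rw [natDegree_prod_of_monic _ _ hmon]
    simp
  have hXn : (X ^ n - 1 : ℤ[X]).natDegree = n := by
    simpa using natDegree_X_pow_sub_C (n := n) (r := (1 : ℤ))
  have hXn' : (X ^ n - 1 : K[X]).natDegree = n := by
    simpa using natDegree_X_pow_sub_C (n := n) (r := (1 : K))
  have hmap : (X ^ n - 1 : ℤ[X]).map (Int.castRingHom K) = X ^ n - 1 := by
    rw [Polynomial.map_sub, Polynomial.map_pow, map_X, Polynomial.map_one]
  have hlin : ∀ i, (X ^ n - 1 : K[X]).resultant (X - C (α i)) n (X - C (α i)).natDegree =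
      (-1) ^ n * (α i ^ n - 1) := by
    intro i
    rw [natDegree_X_sub_C, resultant_X_sub_C_right _ _ _ hXn'.le, eval_sub, eval_pow, eval_X,
      eval_one]
  rw [cyclicResultant, ← eq_intCast (Int.castRingHom K), ← resultant_map_map, hfac, hXn,
    resultant_C_mul_right, hdeg]
  rw [hmap, resultant_prod_right _ _ _ _ hXn'.le (by simp)]
  rw [Finset.prod_congr rfl fun i _ => hlin i,
    Finset.prod_mul_distrib, Finset.prod_const, Finset.card_univ, hcard, ← pow_mul]
  ring

end CyclicResultant

/-! ### Limits of the factors of the resultant -/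

section Limits

variable {p : ℕ} [hp : Fact p.Prime] {ι : Type*} [Fintype ι]

/-- `ℤ_[p]` is complete and embeds isometrically in `ℂ_[p]`, so its image is closed. -/
theorem exists_padicInt_limit {z : ℕ → ℤ} {l : ℂ_[p]}
    (h : Tendsto (fun n => (z n : ℂ_[p])) atTop (𝓝 l)) :
    ∃ L : ℤ_[p], Tendsto (fun n => (z n : ℤ_[p])) atTop (𝓝 L) ∧
      algebraMap ℚ_[p] ℂ_[p] (L : ℚ_[p]) = l := by
  have hiso : Isometry fun x : ℤ_[p] => algebraMap ℚ_[p] ℂ_[p] (x : ℚ_[p]) :=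
    (algebraMap_isometry ℚ_[p] ℂ_[p]).comp isometry_subtype_coe
  have hcl := hiso.isClosedEmbedding
  have hz : ∀ n, algebraMap ℚ_[p] ℂ_[p] ((z n : ℤ_[p]) : ℚ_[p]) = (z n : ℂ_[p]) := by
    intro n
    rw [PadicInt.coe_intCast, map_intCast]
  obtain ⟨L, rfl⟩ := hcl.isClosed_range.mem_of_tendsto h
    (Eventually.of_forall fun n => ⟨(z n : ℤ_[p]), hz n⟩)
  refine ⟨L, ?_, rfl⟩
  rw [hcl.isInducing.tendsto_nhds_iff]
  exact h.congr fun n => (hz n).symm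

theorem norm_intCast_eq_zpow_padicValInt {x : ℤ} (hx : x ≠ 0) :
    ‖(x : ℚ_[p])‖ = (p : ℝ) ^ (-(padicValInt p x : ℤ)) := by
  rw [Padic.norm_eq_zpow_neg_valuation (by exact_mod_cast hx), Padic.valuation_intCast]

theorem nonPPart_cast_eq {x : ℤ} (hx : x ≠ 0) {e : ℤ} (he : ‖(x : ℚ_[p])‖ = (p : ℝ) ^ (-e)) :
    ((nonPPart p x : ℤ) : ℂ_[p]) = x * (p : ℂ_[p]) ^ (-e) := by
  have hp1 : (1 : ℝ) < p := by exact_mod_cast hp.out.one_lt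
  rw [norm_intCast_eq_zpow_padicValInt hx] at he
  have hev := neg_injective (zpow_right_injective₀ (by positivity) hp1.ne' he)
  obtain ⟨y, hy⟩ : (p : ℤ) ^ padicValInt p x ∣ x := padicValInt_dvd x
  have hp0 : (p : ℤ) ^ padicValInt p x ≠ 0 := pow_ne_zero _ (by exact_mod_cast hp.out.ne_zero)
  have hnon : nonPPart p x = y := by
    rw [nonPPart, Int.ediv_eq_of_eq_mul_right hp0 hy]
  have hx' : (x : ℂ_[p]) = (p : ℂ_[p]) ^ padicValInt p x * y := by
    have := congrArg (Int.cast (R := ℂ_[p])) hy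
    push_cast at this
    exact this
  rw [hnon, ← hev, hx', zpow_neg, zpow_natCast, mul_comm, ← mul_assoc,
    inv_mul_cancel₀ (pow_ne_zero _ (prime_ne_zero ℂ_[p] p)), one_mul]

/-- Reindexing by `σ` absorbs one `p`-th power. The function `h` is left general because it serves
both for `z - 1` and for its variant with the value at `z = 1` replaced by `1`. -/
theorem prod_filter_frobenius_pow {M : Type*} [CommMonoid M] {S : ι → Prop} [DecidablePred S]
    {ζ : ι → ℂ_[p]} (σ : Equiv.Perm {i // S i}) (hσ : ∀ i, ζ (σ i) = ζ i ^ p) (h : ℂ_[p] → M)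
    (n : ℕ) : ∏ i with S i, h (ζ i ^ p ^ n) = ∏ i with S i, h (ζ i) := by
  induction n with
  | zero => simp
  | succ n ih =>
    rw [← ih, Finset.prod_subtype (F := inferInstance) _ (p := S) (by simp),
      Finset.prod_subtype (F := inferInstance) _ (p := S) (by simp),
      ← Equiv.prod_comp σ fun i : {i // S i} => h (ζ i ^ p ^ n)]
    refine Finset.prod_congr rfl fun i _ => ?_
    rw [hσ, ← pow_mul, pow_succ']

theorem tendsto_prod_pow_sub_one {κ : Type*} {α ζ : κ → ℂ_[p]} (s : Finset κ) (hα : ∀ i ∈ s, ‖α i‖ = 1)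
    (hζ : ∀ i ∈ s, IsTeichmullerRep p (α i) (ζ i))
    (hprod : ∀ n : ℕ, ∏ i ∈ s, (ζ i ^ p ^ n - 1) = ∏ i ∈ s, (ζ i - 1)) :
    Tendsto (fun n : ℕ => ∏ i ∈ s, (α i ^ p ^ n - 1)) atTop (𝓝 (∏ i ∈ s, (ζ i - 1))) := by
  have h := tendsto_prod_sub_prod_zero s (x := fun i n => α i ^ p ^ n - 1)
    (y := fun i n => ζ i ^ p ^ n - 1)
    (fun i hi n => norm_sub_one_le_one (by rw [norm_pow, hα i hi, one_pow]))
    (fun i hi n => norm_sub_one_le_one (by rw [norm_pow, (hζ i hi).norm_eq_one, one_pow]))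
    (fun i hi => by
      simp only [sub_sub_sub_cancel_right]
      exact tendsto_pow_prime_pow_sub p (hζ i hi).norm_eq_one (hζ i hi).2.2)
  simp only [hprod] at h
  have h' := h.add_const (∏ i ∈ s, (ζ i - 1))
  simpa only [sub_add_cancel, zero_add] using h'

theorem tendsto_pow_prime_pow_zero {x : ℂ_[p]} (hx : ‖x‖ < 1) :
    Tendsto (fun n : ℕ => x ^ p ^ n) atTop (𝓝 0) :=
  (tendsto_pow_atTop_nhds_zero_of_norm_lt_one hx).comp
    (tendsto_pow_atTop_atTop_of_one_lt hp.out.one_lt)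

/-- Only the parity of `p ^ n` matters; at `n = 0` it differs from that of `p` when `p = 2`. -/
theorem neg_one_pow_prime_pow_mul {R : Type*} [Ring R] {n : ℕ} (hn : n ≠ 0) (D : ℕ) :
    (-1 : R) ^ (p ^ n * D) = (-1) ^ (p * D) := by
  rw [pow_mul, pow_mul]
  congr 1
  rcases hp.out.eq_two_or_odd' with rfl | hodd
  · rw [(even_two.pow_of_ne_zero hn).neg_one_pow, even_two.neg_one_pow]
  · rw [hodd.pow.neg_one_pow, hodd.neg_one_pow]

theorem tendsto_nonunit_factor (α : ι → ℂ_[p]) {c ξ : ℂ_[p]} (hc : IsTeichmullerRep p c ξ)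
    (hξ : ξ ^ p = ξ) (D : ℕ) :
    Tendsto (fun n : ℕ => (-1) ^ (p ^ n * D) * c ^ p ^ n *
        (∏ i with 1 < ‖α i‖, (1 - (α i)⁻¹ ^ p ^ n)) * ∏ i with ‖α i‖ < 1, (α i ^ p ^ n - 1)) atTop
      (𝓝 ((-1) ^ (p * D + Finset.card {i | ‖α i‖ < 1}) * ξ)) := by
  have h1 : Tendsto (fun n : ℕ => (-1 : ℂ_[p]) ^ (p ^ n * D)) atTop (𝓝 ((-1) ^ (p * D))) := by
    refine tendsto_const_nhds.congr' ?_
    filter_upwards [eventually_ne_atTop 0] with n hn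
    exact (neg_one_pow_prime_pow_mul hn D).symm
  have hξn : ∀ n : ℕ, ξ ^ p ^ n = ξ := by
    intro n
    induction n with
    | zero => simp
    | succ n ih => rw [pow_succ, pow_mul, ih, hξ]
  have h2 : Tendsto (fun n : ℕ => c ^ p ^ n) atTop (𝓝 ξ) := by
    have := (tendsto_pow_prime_pow_sub p hc.norm_eq_one hc.2.2).add_const ξ
    simpa [hξn] using this
  have h3 : Tendsto (fun n : ℕ => ∏ i with 1 < ‖α i‖, (1 - (α i)⁻¹ ^ p ^ n)) atTop
      (𝓝 (∏ i with 1 < ‖α i‖, (1 - 0))) := by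
    refine tendsto_finsetProd _ fun i hi => (tendsto_pow_prime_pow_zero ?_).const_sub 1
    rw [norm_inv]
    exact inv_lt_one_of_one_lt₀ (Finset.mem_filter.mp hi).2
  have h4 : Tendsto (fun n : ℕ => ∏ i with ‖α i‖ < 1, (α i ^ p ^ n - 1)) atTop
      (𝓝 (∏ i with ‖α i‖ < 1, (0 - 1))) :=
    tendsto_finsetProd _ fun i hi =>
      (tendsto_pow_prime_pow_zero (Finset.mem_filter.mp hi).2).sub_const 1
  have h5 := ((h1.mul h2).mul h3).mul h4
  convert h5 using 2
  simp only [sub_zero, zero_sub, Finset.prod_const, one_pow, mul_one, pow_add]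
  ring

theorem pow_mul_prod_pow_sub_one {K : Type*} [NormedField K] (α : ι → K) (b : K) (N : ℕ) :
    b ^ N * ∏ i, (α i ^ N - 1) =
      (b * ∏ i with 1 < ‖α i‖, α i) ^ N * (∏ i with 1 < ‖α i‖, (1 - (α i)⁻¹ ^ N)) *
        (∏ i with ‖α i‖ < 1, (α i ^ N - 1)) * ∏ i with ‖α i‖ = 1, (α i ^ N - 1) := by
  have h : ∏ i with 1 < ‖α i‖, (α i ^ N - 1) =
      (∏ i with 1 < ‖α i‖, α i) ^ N * ∏ i with 1 < ‖α i‖, (1 - (α i)⁻¹ ^ N) := by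
    rw [← Finset.prod_pow, ← Finset.prod_mul_distrib]
    refine Finset.prod_congr rfl fun i hi => ?_
    have h0 : α i ≠ 0 := norm_pos_iff.mp (one_pos.trans (Finset.mem_filter.mp hi).2)
    rw [mul_sub, mul_one, ← mul_pow, mul_inv_cancel₀ h0, one_pow]
  rw [prod_eq_prod_norm_trichotomy α, h, mul_pow]
  ring

theorem prod_unit_eq_prod_residue_ne_one_mul {K M : Type*} [NormedField K] [IsUltrametricDist K]
    [CommMonoid M] (α : ι → K) (F : ι → M) :
    ∏ i with ‖α i‖ = 1, F i = (∏ i with ‖α i‖ = 1 ∧ ‖α i - 1‖ = 1, F i) *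
      ∏ i with ‖α i‖ = 1 ∧ ‖α i - 1‖ < 1, F i := by
  simp only [Finset.prod_filter, ← Finset.prod_mul_distrib]
  refine Finset.prod_congr rfl fun i _ => ?_
  by_cases h : ‖α i‖ = 1
  · rcases (norm_sub_one_le_one h).lt_or_eq with h1 | h1
    · simp [h, h1, h1.ne]
    · simp [h, h1]
  · simp [h]

theorem filter_norm_sub_one_lt_one {K : Type*} [NormedField K] [IsUltrametricDist K] (α : ι → K) :
    ({i | ‖α i - 1‖ < 1} : Finset ι) =
      ({i | ‖α i‖ = 1 ∧ ‖α i - 1‖ < 1} : Finset ι) :=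
  Finset.filter_congr fun _ _ =>
    ⟨fun h => ⟨norm_eq_one_of_norm_sub_one_lt_one h, h⟩, fun h => h.2⟩

/-- This computes the norm of the primitive part at `1`: large roots contribute `‖α i‖`, absorbed
into the normalized leading coefficient, and all others away from `1` contribute one. -/
theorem norm_mul_prod_one_sub {K : Type*} [NormedField K] [IsUltrametricDist K] (α : ι → K) {b : K}
    (hb : ‖b * ∏ i with 1 < ‖α i‖, α i‖ = 1) :
    ‖b * ∏ i, (1 - α i)‖ = ∏ i with ‖α i - 1‖ < 1, ‖α i - 1‖ := by
  rw [filter_norm_sub_one_lt_one, prod_eq_prod_norm_trichotomy α,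
    prod_unit_eq_prod_residue_ne_one_mul]
  simp only [norm_mul, norm_prod] at hb ⊢
  simp only [norm_sub_rev (1 : K)]
  rw [Finset.prod_congr rfl fun i hi => norm_sub_one_of_one_lt_norm (Finset.mem_filter.mp hi).2,
    Finset.prod_congr (s₁ := {i | ‖α i‖ < 1}) rfl fun i hi =>
      norm_sub_one_of_norm_lt_one (Finset.mem_filter.mp hi).2,
    Finset.prod_congr (s₁ := {i | ‖α i‖ = 1 ∧ ‖α i - 1‖ = 1}) rfl fun i hi =>
      (Finset.mem_filter.mp hi).2.2]
  simp only [Finset.prod_const_one, mul_one, one_mul]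
  rw [← mul_assoc, hb, one_mul]

theorem pow_pred_lt_inv_of_lt_rpow {x : ℝ} (hx : 0 ≤ x)
    (h : x < (p : ℝ) ^ (-1 / ((p : ℝ) - 1))) : x ^ (p - 1) < (p : ℝ)⁻¹ := by
  have hp1 : (1 : ℝ) < p := by exact_mod_cast hp.out.one_lt
  have hp0 : p - 1 ≠ 0 := by have := hp.out.two_le; omega
  have hcast : ((p - 1 : ℕ) : ℝ) = (p : ℝ) - 1 := by
    rw [Nat.cast_sub hp.out.one_le, Nat.cast_one]
  calc x ^ (p - 1) < ((p : ℝ) ^ (-1 / ((p : ℝ) - 1))) ^ (p - 1) := pow_lt_pow_left₀ h hx hp0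
    _ = (p : ℝ)⁻¹ := by
      rw [← Real.rpow_natCast, ← Real.rpow_mul (by positivity), hcast,
        div_mul_cancel₀ _ (by linarith : (p : ℝ) - 1 ≠ 0), Real.rpow_neg_one]

end Limits

theorem exists_primitive_part {p : ℕ} {ι : Type*} [Fintype ι] {f : ℤ[X]} {μ : ℕ} (hμ : (C (p : ℤ)) ^ μ ∣ f)
    (hμ' : ¬ (C (p : ℤ)) ^ (μ + 1) ∣ f) {K : Type*} [Field K] (hpK : (p : K) ≠ 0) {a : K} {α : ι → K}
    (hfac : f.map (Int.castRingHom K) = C a * ∏ i, (X - C (α i))) :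
    ∃ g : ℤ[X], ¬ C (p : ℤ) ∣ g ∧
      g.map (Int.castRingHom K) = C ((p : K) ^ (-(μ : ℤ)) * a) * ∏ i, (X - C (α i)) := by
  obtain ⟨g, rfl⟩ := hμ
  refine ⟨g, fun hg => hμ' ?_, ?_⟩
  · rw [pow_succ]
    exact mul_dvd_mul_left _ hg
  · rw [C_mul, mul_assoc, ← hfac, Polynomial.map_mul, Polynomial.map_pow, map_C, ← mul_assoc,
      ← C_pow, ← C_mul, zpow_neg, zpow_natCast, eq_intCast, Int.cast_natCast,
      inv_mul_cancel₀ (pow_ne_zero _ hpK), C_1, one_mul]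

/-! ### Assembling the limits -/

section MainResults

variable {p : ℕ} [hp : Fact p.Prime] {ι : Type*} [Fintype ι]

theorem teichmullerRep_perm_eq_pow {κ : Type*} {α ζ : κ → ℂ_[p]} (σ : Equiv.Perm {i // ‖α i‖ = 1})
    (hσ : ∀ i, ‖α (σ i) - α i ^ p‖ < 1) (hζ : ∀ i, ‖α i‖ = 1 → IsTeichmullerRep p (α i) (ζ i))
    (i : {i // ‖α i‖ = 1}) : ζ (σ i) = ζ i ^ p :=
  (hζ _ (σ i).2).eq (((hζ _ i.2).pow i.2 p).congr (hσ i))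

/-- Iterating up to the order of `σ` yields `α i ^ p ^ k ≡ α i` with `k > 0`. -/
theorem existsUnique_teichmullerRep_of_perm {α : ι → ℂ_[p]} (σ : Equiv.Perm {i // ‖α i‖ = 1})
    (hσ : ∀ i, ‖α (σ i) - α i ^ p‖ < 1) (i : ι) (hi : ‖α i‖ = 1) :
    ∃! z, IsTeichmullerRep p (α i) z := by
  have key : ∀ (k : ℕ) (j : {i // ‖α i‖ = 1}), ‖α ((σ ^ k) j) - α j ^ p ^ k‖ < 1 := by
    intro k j
    induction k with
    | zero => simp
    | succ k ih =>
      rw [pow_succ' σ, Equiv.Perm.mul_apply, pow_succ p, pow_mul]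
      refine norm_sub_lt_one_trans (hσ _) (norm_pow_sub_pow_lt_one ((σ ^ k) j).2.le ?_ ih p)
      rw [norm_pow, j.2, one_pow]
  have h := key (orderOf σ) ⟨i, hi⟩
  rw [pow_orderOf_eq_one, Equiv.Perm.one_apply, norm_sub_rev] at h
  exact existsUnique_isTeichmullerRep (orderOf_pos σ).ne' hi h

/-- `σ` acts on all unit roots, so the product is first extended to them by giving the value `1` to
those with `ζ i = 1`; taking `p`-power powers does not change which these are. -/
theorem prod_residue_ne_one_frobenius_pow {α ζ : ι → ℂ_[p]} (σ : Equiv.Perm {i // ‖α i‖ = 1})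
    (hσ : ∀ i, ζ (σ i) = ζ i ^ p) (hζ : ∀ i, ‖α i‖ = 1 → IsTeichmullerRep p (α i) (ζ i)) (n : ℕ) :
    ∏ i with ‖α i‖ = 1 ∧ ‖α i - 1‖ = 1, (ζ i ^ p ^ n - 1) =
      ∏ i with ‖α i‖ = 1 ∧ ‖α i - 1‖ = 1, (ζ i - 1) := by
  classical
  have key : ∀ n : ℕ, ∏ i with ‖α i‖ = 1 ∧ ‖α i - 1‖ = 1, (ζ i ^ p ^ n - 1) =
      ∏ i with ‖α i‖ = 1, (fun z : ℂ_[p] => if z = 1 then 1 else z - 1) (ζ i ^ p ^ n) := by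
    intro n
    simp only [Finset.prod_filter]
    refine Finset.prod_congr rfl fun i _ => ?_
    by_cases hi : ‖α i‖ = 1
    · simp only [hi, true_and, if_true, (hζ i hi).pow_prime_pow_eq_one_iff n, (hζ i hi).eq_one_iff]
      rcases (norm_sub_one_le_one hi).lt_or_eq with h1 | h1
      · simp [h1, h1.ne]
      · simp [h1]
    · simp [hi]
  have e := prod_filter_frobenius_pow σ hσ fun z : ℂ_[p] => if z = 1 then 1 else z - 1
  exact (key n).trans ((e n).trans ((e 0).symm.trans ((key 0).symm.trans (by simp))))

theorem norm_teichmullerRep_sub_one {a z : ℂ_[p]} (h : IsTeichmullerRep p a z) (ha : ‖a - 1‖ = 1) :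
    ‖z - 1‖ = 1 := by
  refine le_antisymm (norm_sub_one_le_one h.norm_eq_one) (not_lt.mp fun h1 => ?_)
  exact (norm_sub_lt_one_trans h.2.2 h1).ne ha

/-- The limits of the resultants, with the `p`-part of the content removed. -/
theorem tendsto_normalized_resultant {α ζ : ι → ℂ_[p]} {b ξ : ℂ_[p]}
    (hξ : IsTeichmullerRep p (b * ∏ i with 1 < ‖α i‖, α i) ξ) (hξp : ξ ^ p = ξ)
    (hζ : ∀ i, ‖α i‖ = 1 → IsTeichmullerRep p (α i) (ζ i))
    (σ : Equiv.Perm {i // ‖α i‖ = 1}) (hσ : ∀ i, ζ (σ i) = ζ i ^ p) (D : ℕ) :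
    Tendsto (fun n : ℕ => (-1) ^ (p ^ n * D) * (b ^ p ^ n * ∏ i, (α i ^ p ^ n - 1))) atTop
      (𝓝 ((-1) ^ (p * D + Finset.card {i | ‖α i‖ < 1}) * ξ * ∏ i with ‖α i‖ = 1, (ζ i - 1))) := by
  have h1 := tendsto_prod_pow_sub_one (p := p) (α := α) (ζ := ζ) {i | ‖α i‖ = 1}
    (fun i hi => (Finset.mem_filter.mp hi).2) (fun i hi => hζ i (Finset.mem_filter.mp hi).2)
    (prod_filter_frobenius_pow σ hσ fun z => z - 1)
  refine ((tendsto_nonunit_factor α hξ hξp D).mul h1).congr fun n => ?_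
  rw [pow_mul_prod_pow_sub_one]
  ring

theorem tendsto_normalized_resultant_div {α ζ : ι → ℂ_[p]} {b ξ : ℂ_[p]}
    (hξ : IsTeichmullerRep p (b * ∏ i with 1 < ‖α i‖, α i) ξ) (hξp : ξ ^ p = ξ)
    (hζ : ∀ i, ‖α i‖ = 1 → IsTeichmullerRep p (α i) (ζ i))
    (σ : Equiv.Perm {i // ‖α i‖ = 1}) (hσ : ∀ i, ζ (σ i) = ζ i ^ p) (D : ℕ) :
    Tendsto (fun n : ℕ => (-1) ^ (p ^ n * D) * (b ^ p ^ n * ∏ i, (α i ^ p ^ n - 1)) /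
        (p : ℂ_[p]) ^ (n * Finset.card {i | ‖α i - 1‖ < 1})) atTop
      (𝓝 ((-1) ^ (p * D + Finset.card {i | ‖α i‖ < 1}) * ξ *
        (∏ i with ‖α i‖ = 1 ∧ ‖α i - 1‖ = 1, (ζ i - 1)) *
        ∏ i with ‖α i‖ = 1 ∧ ‖α i - 1‖ < 1, padicComplexLog p (α i))) := by
  have h1 := tendsto_prod_pow_sub_one (p := p) (α := α) (ζ := ζ) {i | ‖α i‖ = 1 ∧ ‖α i - 1‖ = 1}
    (fun i hi => (Finset.mem_filter.mp hi).2.1) (fun i hi => hζ i (Finset.mem_filter.mp hi).2.1)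
    (prod_residue_ne_one_frobenius_pow σ hσ hζ)
  have h2 : Tendsto (fun n : ℕ => ∏ i with ‖α i‖ = 1 ∧ ‖α i - 1‖ < 1,
      ((α i ^ p ^ n - 1) / (p : ℂ_[p]) ^ n)) atTop
      (𝓝 (∏ i with ‖α i‖ = 1 ∧ ‖α i - 1‖ < 1, padicComplexLog p (α i))) :=
    tendsto_finsetProd _ fun i hi => tendsto_pow_sub_one_div_log p (Finset.mem_filter.mp hi).2.2
  refine (((tendsto_nonunit_factor α hξ hξp D).mul h1).mul h2).congr fun n => ?_
  rw [pow_mul_prod_pow_sub_one, prod_unit_eq_prod_residue_ne_one_mul, Finset.prod_div_distrib,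
    Finset.prod_const, ← pow_mul, filter_norm_sub_one_lt_one]
  ring

end MainResults

theorem theorem4p6 (p : ℕ) [Fact p.Prime]
    -- the fixed embedding of the algebraic closure of `ℚ` into `ℂ_p`
    (ι : AlgebraicClosure ℚ →+* ℂ_[p])
    (f : ℤ[X]) (hf : f ≠ 0)
    -- `p ^ μ` is the maximal power of `p` dividing `f`
    (μ : ℕ) (hμ : (C (p : ℤ)) ^ μ ∣ f) (hμ' : ¬ (C (p : ℤ)) ^ (μ + 1) ∣ f)
    -- `f = a₀ ∏ (t - α i)` over the algebraic closure of `ℚ`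
    (d : ℕ) (a₀ : AlgebraicClosure ℚ) (α : Fin d → AlgebraicClosure ℚ)
    (hfac : f.map (Int.castRingHom (AlgebraicClosure ℚ)) = C a₀ * ∏ i, (X - C (α i))) :
    -- existence and uniqueness of `ξ` and of the `ζ i`
    ‖(p : ℂ_[p]) ^ (-(μ : ℤ)) * ι a₀ * ∏ i with 1 < ‖ι (α i)‖, ι (α i)‖ = 1 ∧
    (∃! ξ : ℂ_[p], IsTeichmullerRep p
      ((p : ℂ_[p]) ^ (-(μ : ℤ)) * ι a₀ * ∏ i with 1 < ‖ι (α i)‖, ι (α i)) ξ) ∧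
    (∀ i, ‖ι (α i)‖ = 1 → ∃! z : ℂ_[p], IsTeichmullerRep p (ι (α i)) z) ∧
    ∀ (ξ : ℂ_[p]) (ζ : Fin d → ℂ_[p]),
      IsTeichmullerRep p
        ((p : ℂ_[p]) ^ (-(μ : ℤ)) * ι a₀ * ∏ i with 1 < ‖ι (α i)‖, ι (α i)) ξ →
      (∀ i, ‖ι (α i)‖ = 1 → IsTeichmullerRep p (ι (α i)) (ζ i)) →
      -- (1)(i)
      (C (p : ℤ) ∣ f →
        Tendsto (fun n : ℕ => ((cyclicResultant (p ^ n) f : ℤ) : ℤ_[p])) atTop (𝓝 0)) ∧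
      -- (1)(ii)
      (¬ C (p : ℤ) ∣ f → ∃ L : ℤ_[p],
        Tendsto (fun n : ℕ => ((cyclicResultant (p ^ n) f : ℤ) : ℤ_[p])) atTop (𝓝 L) ∧
        algebraMap ℚ_[p] ℂ_[p] (L : ℚ_[p]) =
          (-1) ^ (p * f.natDegree + Finset.card {i | ‖ι (α i)‖ < 1}) * ξ *
            ∏ i with ‖ι (α i)‖ = 1, (ζ i - 1) ∧
        (L = 0 ↔ ∃ i, ‖ι (α i)‖ = 1 ∧ ζ i = 1)) ∧
      -- (2) and the Iwasawa invariants
      ((∀ n : ℕ, cyclicResultant (p ^ n) f ≠ 0) → ∃ ν : ℤ,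
        (p : ℝ) ^ (-ν) = ∏ i with ‖ι (α i) - 1‖ < 1, ‖padicComplexLog p (ι (α i))‖ ∧
        (∃ L : ℤ_[p],
          Tendsto (fun n : ℕ => ((nonPPart p (cyclicResultant (p ^ n) f) : ℤ) : ℤ_[p]))
            atTop (𝓝 L) ∧
          algebraMap ℚ_[p] ℂ_[p] (L : ℚ_[p]) =
            (-1) ^ (p * f.natDegree + Finset.card {i | ‖ι (α i)‖ < 1}) * ξ *
              (∏ i with ‖ι (α i)‖ = 1 ∧ ‖ι (α i) - 1‖ = 1, (ζ i - 1)) *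
              (p : ℂ_[p]) ^ (-ν) *
              ∏ i with ‖ι (α i)‖ = 1 ∧ ‖ι (α i) - 1‖ < 1, padicComplexLog p (ι (α i))) ∧
        ((∀ i, ‖ι (α i) - 1‖ < 1 → ‖ι (α i) - 1‖ < (p : ℝ) ^ (-1 / ((p : ℝ) - 1))) →
          (p : ℝ) ^ ν = ‖(p : ℚ_[p]) ^ (-(μ : ℤ)) * ((f.eval 1 : ℤ) : ℚ_[p])‖⁻¹) ∧
        IsIwasawaInvariants p f (Finset.card {i | ‖ι (α i) - 1‖ < 1}) μ ν) := by
  have hinj : (p : ℂ_[p]) ≠ 0 := prime_ne_zero ℂ_[p] p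
  have hpR : (1 : ℝ) < p := by exact_mod_cast (Fact.out : p.Prime).one_lt
  have hfacK : f.map (Int.castRingHom ℂ_[p]) = C (ι a₀) * ∏ i, (X - C (ι (α i))) := by
    have h := congrArg (Polynomial.map ι) hfac
    rw [Polynomial.map_map, Polynomial.map_mul, map_C, Polynomial.map_prod] at h
    simp only [Polynomial.map_sub, map_X, map_C] at h
    rw [← h]
    congr 1
    exact RingHom.ext_int _ _
  obtain ⟨g, hg, hgfac⟩ := exists_primitive_part hμ hμ' hinj hfacK
  obtain ⟨hc1, hcp, σ, hσ⟩ := frobenius_permutes_unit_roots p hg hgfac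
  refine ⟨hc1, existsUnique_isTeichmullerRep one_ne_zero hc1 (by rwa [pow_one]),
    existsUnique_teichmullerRep_of_perm σ hσ, fun ξ ζ hξ hζ => ?_⟩
  set b : ℂ_[p] := (p : ℂ_[p]) ^ (-(μ : ℤ)) * ι a₀ with hb
  have hξp : ξ ^ p = ξ := by
    refine (hξ.pow hc1 p).eq (hξ.congr hcp)
  have hσζ := teichmullerRep_perm_eq_pow σ hσ hζ
  have ha : ι a₀ = (p : ℂ_[p]) ^ μ * b := by
    rw [hb, ← mul_assoc, zpow_neg, zpow_natCast, mul_inv_cancel₀ (pow_ne_zero _ hinj), one_mul]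
  have hres : ∀ n : ℕ, ((cyclicResultant n f : ℤ) : ℂ_[p]) = (p : ℂ_[p]) ^ (μ * n) *
      ((-1) ^ (n * f.natDegree) * (b ^ n * ∏ i, (ι (α i) ^ n - 1))) := by
    intro n
    rw [cyclicResultant_eq hf hfacK, ha, mul_pow, ← pow_mul]
    ring
  have hlim := tendsto_normalized_resultant hξ hξp hζ σ hσζ f.natDegree
  refine ⟨fun hdvd => ?_, fun hndvd => ?_, fun hne => ?_⟩
  · have hμ0 : μ ≠ 0 := by
      rintro rfl
      rw [zero_add, pow_one] at hμ'
      exact hμ' hdvd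
    have hp0 : Tendsto (fun n : ℕ => (p : ℂ_[p]) ^ (μ * p ^ n)) atTop (𝓝 0) := by
      simp only [pow_mul]
      refine tendsto_pow_prime_pow_zero ?_
      rw [norm_pow]
      exact pow_lt_one₀ (norm_nonneg _) (norm_prime_lt_one ℂ_[p] p) hμ0
    have h := hp0.mul hlim
    rw [zero_mul] at h
    obtain ⟨L, hL, hL0⟩ := exists_padicInt_limit (h.congr fun n => (hres (p ^ n)).symm)
    rw [map_eq_zero] at hL0
    rwa [show L = 0 from Subtype.ext hL0] at hL
  · have hμ0 : μ = 0 := by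
      by_contra h
      exact hndvd ((dvd_pow_self _ h).trans hμ)
    have hres' : ∀ n : ℕ, (-1) ^ (p ^ n * f.natDegree) *
        (b ^ p ^ n * ∏ i, (ι (α i) ^ p ^ n - 1)) = ((cyclicResultant (p ^ n) f : ℤ) : ℂ_[p]) := by
      intro n
      rw [hres, hμ0, zero_mul, pow_zero, one_mul]
    obtain ⟨L, hL, hLeq⟩ := exists_padicInt_limit (hlim.congr hres')
    refine ⟨L, hL, hLeq, ?_⟩
    have hL0 : L = 0 ↔ algebraMap ℚ_[p] ℂ_[p] (L : ℚ_[p]) = 0 := by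
      rw [map_eq_zero]
      exact ⟨fun h => by simp [h], fun h => Subtype.ext h⟩
    rw [hL0, hLeq, mul_eq_zero, or_iff_right
      (mul_ne_zero (pow_ne_zero _ (neg_ne_zero.mpr one_ne_zero)) hξ.ne_zero), Finset.prod_eq_zero_iff]
    simp [sub_eq_zero]
  -- A root that is a `p`-power root of unity would make some resultant vanish.
  · have hpow : ∀ i (n : ℕ), ι (α i) ^ p ^ n ≠ 1 := by
      intro i n h
      have h0 : ((cyclicResultant (p ^ n) f : ℤ) : ℂ_[p]) = 0 := by
        rw [hres, Finset.prod_eq_zero (Finset.mem_univ i) (sub_eq_zero.mpr h)]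
        simp
      exact hne n (by exact_mod_cast h0)
    have hdiv := tendsto_normalized_resultant_div hξ hξp hζ σ hσζ f.natDegree
    set lam := Finset.card {i | ‖ι (α i) - 1‖ < 1} with hlam
    set V : ℕ → ℂ_[p] := fun n => (-1) ^ (p ^ n * f.natDegree) *
      (b ^ p ^ n * ∏ i, (ι (α i) ^ p ^ n - 1)) / (p : ℂ_[p]) ^ (n * lam) with hV
    set V₀ : ℂ_[p] := (-1) ^ (p * f.natDegree + Finset.card {i | ‖ι (α i)‖ < 1}) * ξ *
        (∏ i with ‖ι (α i)‖ = 1 ∧ ‖ι (α i) - 1‖ = 1, (ζ i - 1)) *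
        ∏ i with ‖ι (α i)‖ = 1 ∧ ‖ι (α i) - 1‖ < 1, padicComplexLog p (ι (α i)) with hV₀
    have hnormV₀ : ‖V₀‖ = ∏ i with ‖ι (α i) - 1‖ < 1, ‖padicComplexLog p (ι (α i))‖ := by
      rw [hV₀, norm_mul, norm_mul, norm_mul, norm_pow, norm_neg, norm_one, one_pow, one_mul,
        hξ.norm_eq_one, one_mul, norm_prod, norm_prod, Finset.prod_eq_one, one_mul,
        filter_norm_sub_one_lt_one]
      intro i hi
      have hi' := (Finset.mem_filter.mp hi).2
      exact norm_teichmullerRep_sub_one (hζ i hi'.1) hi'.2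
    have hlog0 : ∀ i, ‖ι (α i) - 1‖ < 1 → padicComplexLog p (ι (α i)) ≠ 0 := fun i hi =>
      log_ne_zero_of_forall_pow_ne_one p hi (hpow i)
    have hV₀ne : V₀ ≠ 0 := by
      rw [← norm_ne_zero_iff, hnormV₀, Finset.prod_ne_zero_iff]
      exact fun i hi => norm_ne_zero_iff.mpr (hlog0 i (Finset.mem_filter.mp hi).2)
    have hresV : ∀ n : ℕ, ((cyclicResultant (p ^ n) f : ℤ) : ℂ_[p]) =
        (p : ℂ_[p]) ^ ((lam : ℤ) * n + (μ : ℤ) * (p : ℤ) ^ n) * V n := by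
      intro n
      have h1 : (lam : ℤ) * n + (μ : ℤ) * (p : ℤ) ^ n = ((n * lam + μ * p ^ n : ℕ) : ℤ) := by
        push_cast
        ring
      rw [hres, hV, h1, zpow_natCast, pow_add, mul_comm ((p : ℂ_[p]) ^ (n * lam)), mul_assoc,
        mul_div_cancel₀ _ (pow_ne_zero _ hinj)]
    have hnormres : ∀ᶠ n : ℕ in atTop, ‖((cyclicResultant (p ^ n) f : ℤ) : ℚ_[p])‖ =
        (p : ℝ) ^ (-((lam : ℤ) * n + (μ : ℤ) * (p : ℤ) ^ n)) * ‖V₀‖ := by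
      filter_upwards [eventually_norm_eq_of_tendsto hdiv hV₀ne] with n hn
      rw [← norm_intCast_eq_padic ℂ_[p] p, hresV, norm_mul, hn, norm_zpow, norm_prime, inv_zpow,
        zpow_neg]
    have hp0 : (p : ℝ) ≠ 0 := (one_pos.trans hpR).ne'
    -- A single late resultant suffices: it is a nonzero integer, so its norm, and hence `‖V₀‖`, is
    -- an integral power of `p`.
    obtain ⟨ν, hν⟩ : ∃ ν : ℤ, ‖V₀‖ = (p : ℝ) ^ (-ν) := by
      obtain ⟨n, hn⟩ := hnormres.exists
      refine ⟨padicValInt p (cyclicResultant (p ^ n) f) -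
        ((lam : ℤ) * n + (μ : ℤ) * (p : ℤ) ^ n), ?_⟩
      rw [norm_intCast_eq_zpow_padicValInt (hne n)] at hn
      rw [neg_sub, sub_eq_add_neg, zpow_add₀ hp0, hn, ← mul_assoc, ← zpow_add₀ hp0, add_neg_cancel,
        zpow_zero, one_mul]
    have hnormres' : ∀ᶠ n : ℕ in atTop, ‖((cyclicResultant (p ^ n) f : ℤ) : ℚ_[p])‖ =
        (p : ℝ) ^ (-((lam : ℤ) * n + (μ : ℤ) * (p : ℤ) ^ n + ν)) := by
      filter_upwards [hnormres] with n hn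
      rw [hn, hν, ← zpow_add₀ hp0, ← neg_add]
    refine ⟨ν, hν.symm.trans hnormV₀, ?_, fun hsmall => ?_, ?_⟩
    · have hnon : Tendsto (fun n : ℕ => ((nonPPart p (cyclicResultant (p ^ n) f) : ℤ) : ℂ_[p])) atTop
          (𝓝 (V₀ * (p : ℂ_[p]) ^ (-ν))) := by
        refine (hdiv.mul_const _).congr' ?_
        filter_upwards [hnormres'] with n hn
        rw [nonPPart_cast_eq (hne n) hn, hresV, mul_right_comm, ← zpow_add₀ hinj, mul_comm (V n)]
        congr 2
        ring
      obtain ⟨L, hL, hLeq⟩ := exists_padicInt_limit hnon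
      refine ⟨L, hL, hLeq.trans ?_⟩
      rw [hV₀]
      ring
    · have hf1 : ((p : ℂ_[p]) ^ (-(μ : ℤ)) * ((f.eval 1 : ℤ) : ℂ_[p])) = b * ∏ i, (1 - ι (α i)) := by
        have h := congrArg (eval 1) hfacK
        rw [eval_mul, eval_C, eval_prod, eval_one_map, eq_intCast] at h
        simp only [eval_sub, eval_X, eval_C] at h
        rw [h, hb, mul_assoc]
      have hnorm : ‖(p : ℚ_[p]) ^ (-(μ : ℤ)) * ((f.eval 1 : ℤ) : ℚ_[p])‖ = (p : ℝ) ^ (-ν) := by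
        rw [← norm_algebraMap' ℂ_[p], map_mul, map_zpow₀, map_natCast, map_intCast, hf1,
          norm_mul_prod_one_sub _ hc1, ← hν, hnormV₀]
        refine Finset.prod_congr rfl fun i hi => ?_
        have hi' := (Finset.mem_filter.mp hi).2
        exact (norm_log_of_norm_sub_one_pow_lt p
          (pow_pred_lt_inv_of_lt_rpow (norm_nonneg _) (hsmall i hi')) hi').symm
      rw [hnorm, zpow_neg, inv_inv]
    · filter_upwards [hnormres'] with n hn
      rw [hn, zpow_neg, inv_inv]
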